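/- Let $K$ be a field and let $\mathcal{C}$ be a small $K$-category, i.e. a small category whose morphism sets $\mathcal{C}(X,Y)$ are $K$-vector spaces and whose composition is $K$-bilinear. Let $\mathcal{I}$ be a two-sided ideal of $\mathcal{C}$: a family of $K$-subspaces $\mathcal{I}(X,Y)\subseteq\mathcal{C}(X,Y)$ closed under composition on either side with arbitrary morphisms of $\mathcal{C}$. Let $\mathcal{I}^{op}$ be the corresponding ideal of $\mathcal{C}^{op}$, with $\mathcal{I}^{op}(X,Y)=\mathcal{I}(Y,X)$. The quotient $\mathcal{C}/\mathcal{I}$ has the objects of $\mathcal{C}$ and morphism spaces $\mathcal{C}(X,Y)/\mathcal{I}(X,Y)$. For a small $K$-category $\mathcal{A}$, let $\mathrm{Mod}(\mathcal{A})$ be the abelian category of $K$-linear functors from $\mathcal{A}$ to the category of $K$-vector spaces. For an ideal $\mathcal{J}$ of $\mathcal{A}$ with canonical projection $\pi:\mathcal{A}\to\mathcal{A}/\mathcal{J}$, let $\pi_{\ast}:\mathrm{Mod}(\mathcal{A}/\mathcal{J})\to\mathrm{Mod}(\mathcal{A})$, $F\mapsto F\circ\pi$, be the (exact) restriction functor.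 One says that $\pi$ is a homological epimorphism if $\mathcal{J}$ is strongly idempotent, that is, if the canonical map induced by $\pi_{\ast}$, $$\mathrm{Ext}^{i}_{\mathrm{Mod}(\mathcal{A}/\mathcal{J})}(F,F')\longrightarrow\mathrm{Ext}^{i}_{\mathrm{Mod}(\mathcal{A})}(\pi_{\ast}F,\pi_{\ast}F'),$$ is an isomorphism for all $F,F'\in\mathrm{Mod}(\mathcal{A}/\mathcal{J})$ and all integers $i\ge 0$. Then the canonical projection $\pi_1:\mathcal{C}\to\mathcal{C}/\mathcal{I}$ is a homological epimorphism if and only if the canonical projection $\pi_2:\mathcal{C}^{op}\to\mathcal{C}^{op}/\mathcal{I}^{op}$ is a homological epimorphism. -/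

import Mathlib

open CategoryTheory CategoryTheory.Limits Opposite

universe u

noncomputable section

namespace KCat

/-! ### The opposite of a `K`-category -/

/-- The opposite of a `K`-linear category is `K`-linear, with the same scalar multiplication. -/
instance linearOpposite (K : Type*) [Semiring K] (C : Type*) [Category* C] [Preadditive C]
    [Linear K C] : Linear K Cᵒᵖ where
  homModule X Y :=
    { smul := fun a f => (a • f.unop).op
      one_smul := fun f => congrArg Quiver.Hom.op (one_smul K f.unop)
      mul_smul := fun a b f => congrArg Quiver.Hom.op (mul_smul a b f.unop)
      smul_zero := fun a => congrArg Quiver.Hom.op (smul_zero (A := unop Y ⟶ unop X) a)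
      smul_add := fun a f g => congrArg Quiver.Hom.op (smul_add a f.unop g.unop)
      add_smul := fun a b f => congrArg Quiver.Hom.op (add_smul a b f.unop)
      zero_smul := fun f => congrArg Quiver.Hom.op (zero_smul K f.unop) }
  smul_comp := fun _ _ _ a f g => congrArg Quiver.Hom.op (Linear.comp_smul _ _ _ g.unop a f.unop)
  comp_smul := fun _ _ _ f a g => congrArg Quiver.Hom.op (Linear.smul_comp _ _ _ a g.unop f.unop)

@[simp]
lemma unop_smul {K : Type*} [Semiring K] {C : Type*} [Category* C] [Preadditive C]
    [Linear K C] {X Y : Cᵒᵖ} (a : K) (f : X ⟶ Y) : (a • f).unop = a • f.unop := rfl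

/-! ### Two-sided ideals and quotient categories -/

/-- A two-sided ideal of a `K`-category: a `K`-subspace of every space of morphisms, stable under
composition with arbitrary morphisms on both sides. -/
structure Ideal (K : Type*) [Semiring K] (C : Type*) [Category* C] [Preadditive C]
    [Linear K C] where
  /-- the subspace `I(X, Y)` of `C(X, Y)` -/
  carrier (X Y : C) : Submodule K (X ⟶ Y)
  comp_mem {X Y Z : C} {f : X ⟶ Y} (hf : f ∈ carrier X Y) (g : Y ⟶ Z) : f ≫ g ∈ carrier X Z
  mem_comp {U X Y : C} (h : U ⟶ X) {f : X ⟶ Y} (hf : f ∈ carrier X Y) : h ≫ f ∈ carrier U Y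

namespace Ideal

variable {K : Type*} [Ring K] {C : Type*} [Category* C] [Preadditive C] [Linear K C]

/-- The opposite ideal of `Cᵒᵖ`, with `Iᵒᵖ(X, Y) = I(Y, X)`. -/
def op (I : Ideal K C) : Ideal K Cᵒᵖ where
  carrier X Y :=
    { carrier := {f | f.unop ∈ I.carrier Y.unop X.unop}
      add_mem' := fun {a b} ha hb => (I.carrier Y.unop X.unop).add_mem (x := a.unop)
        (y := b.unop) ha hb
      zero_mem' := (I.carrier Y.unop X.unop).zero_mem
      smul_mem' := fun c f hf => (I.carrier Y.unop X.unop).smul_mem (x := f.unop) c hf }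
  comp_mem hf g := I.mem_comp g.unop hf
  mem_comp h _ hf := I.comp_mem hf h.unop

variable (I : Ideal K C)

/-- Two parallel morphisms are identified in the quotient when their difference is in `I`. -/
def rel : HomRel C := fun X Y f g => f - g ∈ I.carrier X Y

instance : Congruence I.rel where
  equivalence {X Y} :=
    { refl := fun f => by simp [rel]
      symm := fun {f g} h => by
        have := (I.carrier X Y).neg_mem h
        rwa [neg_sub] at this
      trans := fun {f g h} h₁ h₂ => by
        have := (I.carrier X Y).add_mem h₁ h₂
        rwa [sub_add_sub_cancel] at this }
  comp_left {X Y Z} f {g g'} h := by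
    have := I.mem_comp f (show g - g' ∈ I.carrier Y Z from h)
    rwa [Preadditive.comp_sub] at this
  comp_right {X Y Z f f'} g h := by
    have := I.comp_mem (show f - f' ∈ I.carrier X Y from h) g
    rwa [Preadditive.sub_comp] at this

lemma rel_add ⦃X Y : C⦄ (f₁ f₂ g₁ g₂ : X ⟶ Y) (h : I.rel f₁ f₂) (h' : I.rel g₁ g₂) :
    I.rel (f₁ + g₁) (f₂ + g₂) := by
  have := (I.carrier X Y).add_mem h h'
  rwa [sub_add_sub_comm] at this

lemma rel_smul (a : K) ⦃X Y : C⦄ (f₁ f₂ : X ⟶ Y) (h : I.rel f₁ f₂) :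
    I.rel (a • f₁) (a • f₂) := by
  have := (I.carrier X Y).smul_mem a h
  rwa [smul_sub] at this

/-- The quotient category `C/I`: same objects as `C`, morphisms `C(X, Y)/I(X, Y)`. -/
abbrev Quot : Type _ := CategoryTheory.Quotient I.rel

instance : Preadditive I.Quot := Quotient.preadditive I.rel I.rel_add

/-- The canonical projection `π : C ⥤ C/I`. -/
abbrev π : C ⥤ I.Quot := Quotient.functor I.rel

instance : I.π.Additive := Quotient.functor_additive I.rel I.rel_add

instance : Linear K I.Quot := Quotient.linear K I.rel I.rel_smul

instance : I.π.Linear K := Quotient.linear_functor K I.rel I.rel_smul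

end Ideal

/-! ### Modules over a small `K`-category -/

section Modules

variable (K : Type u) [Field K]

/-- The property of a functor `C ⥤ Mod K` of being a `K`-functor. -/
def isLinear (C : Type u) [SmallCategory C] [Preadditive C] [Linear K C] :
    ObjectProperty (C ⥤ ModuleCat.{u} K) :=
  fun M => M.Additive ∧ M.Linear K

/-- `Mod(C) = Fun_K(C, Mod(K))`, the category of `K`-functors from `C` to `K`-vector spaces. -/
abbrev Mod (C : Type u) [SmallCategory C] [Preadditive C] [Linear K C] : Type (u + 1) :=
  (isLinear K C).FullSubcategory

variable {C D : Type u} [SmallCategory C] [Preadditive C] [Linear K C]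
  [SmallCategory D] [Preadditive D] [Linear K D]

lemma isLinear_of_isLimit {J : Type} [SmallCategory J] {F : J ⥤ C ⥤ ModuleCat.{u} K} {c : Cone F}
    (hc : IsLimit c) (h : ∀ j, isLinear K C (F.obj j)) : isLinear K C c.pt := by
  have hom_ext {X : C} {Z : ModuleCat.{u} K} {f g : Z ⟶ c.pt.obj X}
      (w : ∀ j, f ≫ (c.π.app j).app X = g ≫ (c.π.app j).app X) : f = g :=
    (isLimitOfPreserves ((evaluation C (ModuleCat.{u} K)).obj X) hc).hom_ext w
  refine ⟨⟨fun {X Y f g} => hom_ext fun j => ?_⟩, ⟨fun {X Y} f a => hom_ext fun j => ?_⟩⟩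
  · have := (h j).1
    simp only [Preadditive.add_comp, NatTrans.naturality, Functor.map_add, Preadditive.comp_add]
  · have := (h j).2
    simp only [Linear.smul_comp, NatTrans.naturality, Functor.map_smul, Linear.comp_smul]

lemma isLinear_of_isColimit {J : Type} [SmallCategory J] {F : J ⥤ C ⥤ ModuleCat.{u} K}
    {c : Cocone F} (hc : IsColimit c) (h : ∀ j, isLinear K C (F.obj j)) : isLinear K C c.pt := by
  have hom_ext {X : C} {Z : ModuleCat.{u} K} {f g : c.pt.obj X ⟶ Z}
      (w : ∀ j, (c.ι.app j).app X ≫ f = (c.ι.app j).app X ≫ g) : f = g :=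
    (isColimitOfPreserves ((evaluation C (ModuleCat.{u} K)).obj X) hc).hom_ext w
  have nat (j : J) {X Y : C} (f : X ⟶ Y) : (c.ι.app j).app X ≫ c.pt.map f =
      (F.obj j).map f ≫ (c.ι.app j).app Y := ((c.ι.app j).naturality f).symm
  refine ⟨⟨fun {X Y f g} => hom_ext fun j => ?_⟩, ⟨fun {X Y} f a => hom_ext fun j => ?_⟩⟩
  · have := (h j).1
    simp only [Preadditive.comp_add, nat, Functor.map_add, Preadditive.add_comp]
  · have := (h j).2
    simp only [Linear.comp_smul, nat, Functor.map_smul, Linear.smul_comp]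

instance {J : Type} [SmallCategory J] : (isLinear K C).IsClosedUnderLimitsOfShape J where
  limitsOfShape_le := by
    rintro M ⟨p⟩
    exact isLinear_of_isLimit K p.isLimit p.prop_diag_obj

instance {J : Type} [SmallCategory J] : (isLinear K C).IsClosedUnderColimitsOfShape J where
  colimitsOfShape_le := by
    rintro M ⟨p⟩
    exact isLinear_of_isColimit K p.isColimit p.prop_diag_obj

instance : (isLinear K C).IsClosedUnderFiniteProducts where

instance : (isLinear K C).IsClosedUnderKernels where
  kernels_le := by
    rintro _ ⟨f, k, hk, hf⟩
    exact isLinear_of_isLimit K hk (by rintro (_ | _); exacts [hf.1, hf.2])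

instance : (isLinear K C).IsClosedUnderCokernels where
  cokernels_le := by
    rintro _ ⟨f, k, hk, hf⟩
    exact isLinear_of_isColimit K hk (by rintro (_ | _); exacts [hf.1, hf.2])

instance : (isLinear K C).ContainsZero where
  exists_zero := ⟨_, isZero_zero _,
    ⟨⟨fun {_ _ _ _} => (IsZero.obj (isZero_zero _) _).eq_of_src _ _⟩,
      ⟨fun _ _ => (IsZero.obj (isZero_zero _) _).eq_of_src _ _⟩⟩⟩

/-- Restriction `Φ_* : Mod(D) ⥤ Mod(C)`, `F ↦ F ∘ Φ`, along a `K`-functor `Φ : C ⥤ D`. -/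
def restrict (Φ : C ⥤ D) [Φ.Additive] [Φ.Linear K] : Mod K D ⥤ Mod K C :=
  (isLinear K C).lift ((isLinear K D).ι ⋙ (Functor.whiskeringLeft C D (ModuleCat.{u} K)).obj Φ)
    (fun M => by
      have := M.property.1
      have := M.property.2
      exact ⟨inferInstanceAs (Φ ⋙ M.obj).Additive, inferInstanceAs ((Φ ⋙ M.obj).Linear K)⟩)

section

variable (Φ : C ⥤ D) [Φ.Additive] [Φ.Linear K]

/-- Restriction commutes with the forgetful functors to all functors. -/
def restrictCompIso : restrict K Φ ⋙ (isLinear K C).ι ≅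
    (isLinear K D).ι ⋙ (Functor.whiskeringLeft C D (ModuleCat.{u} K)).obj Φ :=
  Iso.refl _

instance : (restrict K Φ).Additive where
  map_add := rfl

instance : (restrict K Φ).Linear K where
  map_smul _ _ := rfl

instance : PreservesFiniteLimits (restrict K Φ) where
  preservesFiniteLimits J _ _ := by
    have : PreservesLimitsOfShape J (restrict K Φ ⋙ (isLinear K C).ι) :=
      preservesLimitsOfShape_of_natIso (restrictCompIso K Φ).symm
    exact preservesLimitsOfShape_of_reflects_of_preserves _ (isLinear K C).ι

instance : PreservesFiniteColimits (restrict K Φ) where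
  preservesFiniteColimits J _ _ := by
    have : PreservesColimitsOfShape J (restrict K Φ ⋙ (isLinear K C).ι) :=
      preservesColimitsOfShape_of_natIso (restrictCompIso K Φ).symm
    exact preservesColimitsOfShape_of_reflects_of_preserves _ (isLinear K C).ι

end

/-- `I` is strongly idempotent: for all `C/I`-modules `F`, `F'` and all `i ≥ 0`, the canonical
`K`-linear map `Ext^i_{Mod(C/I)}(F, F') → Ext^i_{Mod(C)}(π_* F, π_* F')` induced by the exact
restriction functor `π_*` is an isomorphism. -/
def Ideal.IsStronglyIdempotent {K : Type u} [Field K] {C : Type u} [SmallCategory C]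
    [Preadditive C] [Linear K C] (I : Ideal K C) : Prop :=
  letI : HasExt.{u + 1} (Mod K I.Quot) := HasExt.standard _
  letI : HasExt.{u + 1} (Mod K C) := HasExt.standard _
  ∀ (F F' : Mod K I.Quot) (i : ℕ),
    Function.Bijective ((restrict K I.π).mapExtLinearMap (X := F) (Y := F') (n := i) (R := K))

/-- The canonical projection `π : C ⥤ C/I` is a homological epimorphism
if `I` is strongly idempotent. -/
def Ideal.ProjectionIsHomologicalEpi {K : Type u} [Field K] {C : Type u} [SmallCategory C]
    [Preadditive C] [Linear K C] (I : Ideal K C) : Prop :=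
  I.IsStronglyIdempotent

end Modules

end KCat

end

noncomputable section

namespace KCat

/-! ### Dimension shifting for the vanishing of Ext groups -/

section DimensionShifting

universe w w' v v' v₁ v₁' u' u₁ u₁'

open Abelian

variable {A : Type u'} [Category.{v} A] [Abelian A] [HasExt.{w} A] {S : ShortComplex A}

/-! The duality `D = Hom_K(-, K)` makes strong idempotence equivalent to a condition that does not
distinguish `C` from `Cᵒᵖ`. Restriction along `π` is exact and fully faithful, so it is bijective on
all Ext groups if and only if `Ext^n(π_* P, π_* Y) = 0` for `n > 0`, `P` projective and `Y`
arbitrary over `C/I`. It is enough to take for `Y` the duals of projective modules `Q` over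
`Cᵒᵖ/Iᵒᵖ`: every `Y` embeds in its double dual, and a projective cover map `Q ↠ D Y` embeds that in
`D Q` (`ExactDuality.mapExt_bijective_iff`).

The condition is now `Ext^n(π_* P, D π_* Q) = 0`. By `ExactDuality.subsingleton_ext_iff` it amounts
to `Ext^n(π_* Q, D π_* P) = 0` over `Cᵒᵖ`, which is the same condition for `Iᵒᵖ`. Classically both
groups are the dual of `Tor_n(π_* Q, π_* P)`. The argument avoids Tor and compares only vanishing,
by dimension shifting down to `Ext¹`, which is a lifting or extension problem for morphisms. -/

lemma subsingleton_ext_one_iff_lift (hS : S.ShortExact) (X : A)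
    (h : Subsingleton (Ext.{w} X S.X₂ 1)) :
    Subsingleton (Ext.{w} X S.X₁ 1) ↔ ∀ f : X ⟶ S.X₃, ∃ g : X ⟶ S.X₂, g ≫ S.g = f := by
  refine ⟨fun _ f => ?_, fun H => subsingleton_of_forall_eq 0 fun x => ?_⟩
  · obtain ⟨x, hx⟩ := Ext.covariant_sequence_exact₃ X hS (Ext.mk₀ f) (zero_add 1)
      (Subsingleton.elim _ _)
    obtain ⟨g, rfl⟩ := (Ext.mk₀_bijective _ _).2 x
    exact ⟨g, (Ext.mk₀_bijective _ _).1 (by simpa using hx)⟩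
  · obtain ⟨y, rfl⟩ := Ext.covariant_sequence_exact₁ X hS x (Subsingleton.elim _ _) (zero_add 1)
    obtain ⟨f, rfl⟩ := (Ext.mk₀_bijective _ _).2 y
    obtain ⟨g, rfl⟩ := H f
    rw [← Ext.mk₀_comp_mk₀, Ext.comp_assoc_of_second_deg_zero, hS.comp_extClass, Ext.comp_zero]

lemma subsingleton_ext_succ_iff_covariant (hS : S.ShortExact) (X : A) (n : ℕ)
    (h : Subsingleton (Ext.{w} X S.X₂ n)) (h' : Subsingleton (Ext.{w} X S.X₂ (n + 1))) :
    Subsingleton (Ext.{w} X S.X₁ (n + 1)) ↔ Subsingleton (Ext.{w} X S.X₃ n) := by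
  refine ⟨fun _ => subsingleton_of_forall_eq 0 fun x => ?_,
    fun _ => subsingleton_of_forall_eq 0 fun x => ?_⟩
  · obtain ⟨y, rfl⟩ := Ext.covariant_sequence_exact₃ X hS x rfl (Subsingleton.elim _ _)
    rw [Subsingleton.elim y 0, Ext.zero_comp]
  · obtain ⟨y, rfl⟩ := Ext.covariant_sequence_exact₁ X hS x (Subsingleton.elim _ _) rfl
    rw [Subsingleton.elim y 0, Ext.zero_comp]

lemma subsingleton_ext_one_iff_extend (hS : S.ShortExact) (Y : A)
    (h : Subsingleton (Ext.{w} S.X₂ Y 1)) :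
    Subsingleton (Ext.{w} S.X₃ Y 1) ↔ ∀ f : S.X₁ ⟶ Y, ∃ g : S.X₂ ⟶ Y, S.f ≫ g = f := by
  refine ⟨fun _ f => ?_, fun H => subsingleton_of_forall_eq 0 fun x => ?_⟩
  · obtain ⟨x, hx⟩ := Ext.contravariant_sequence_exact₁ hS Y (Ext.mk₀ f) (add_zero 1)
      (Subsingleton.elim _ _)
    obtain ⟨g, rfl⟩ := (Ext.mk₀_bijective _ _).2 x
    exact ⟨g, (Ext.mk₀_bijective _ _).1 (by simpa using hx)⟩
  · obtain ⟨y, rfl⟩ :=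
      Ext.contravariant_sequence_exact₃ hS Y x (Subsingleton.elim _ _) (add_zero 1)
    obtain ⟨f, rfl⟩ := (Ext.mk₀_bijective _ _).2 y
    obtain ⟨g, rfl⟩ := H f
    rw [← Ext.mk₀_comp_mk₀, hS.extClass_comp_assoc]

lemma subsingleton_ext_succ_iff_contravariant (hS : S.ShortExact) (Y : A) (n : ℕ)
    (h : Subsingleton (Ext.{w} S.X₂ Y n)) (h' : Subsingleton (Ext.{w} S.X₂ Y (n + 1))) :
    Subsingleton (Ext.{w} S.X₃ Y (n + 1)) ↔ Subsingleton (Ext.{w} S.X₁ Y n) := by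
  refine ⟨fun _ => subsingleton_of_forall_eq 0 fun x => ?_,
    fun _ => subsingleton_of_forall_eq 0 fun x => ?_⟩
  · obtain ⟨y, rfl⟩ := Ext.contravariant_sequence_exact₁ hS Y x (add_comm 1 n)
      (Subsingleton.elim _ _)
    rw [Subsingleton.elim y 0, Ext.comp_zero]
  · obtain ⟨y, rfl⟩ :=
      Ext.contravariant_sequence_exact₃ hS Y x (Subsingleton.elim _ _) (add_comm 1 n)
    rw [Subsingleton.elim y 0, Ext.comp_zero]

lemma subsingleton_ext_of_iso {X X' Y Y' : A} (e : X ≅ X') (e' : Y ≅ Y') (n : ℕ)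
    [Subsingleton (Ext.{w} X Y n)] : Subsingleton (Ext.{w} X' Y' n) := by
  refine subsingleton_of_forall_eq 0 fun x => ?_
  have h : ((Ext.mk₀ e.hom).comp x (zero_add n)).comp (Ext.mk₀ e'.inv) (add_zero n) = 0 :=
    Subsingleton.elim _ _
  have h' := congrArg (fun y => ((Ext.mk₀ e.inv).comp y (zero_add n)).comp (Ext.mk₀ e'.hom)
    (add_zero n)) h
  simpa using h'

end DimensionShifting

/-! ### Contravariant exact dualities and the symmetry of Ext vanishing -/

section

universe w w' v v' v₁ v₁' u' u'' u₁ u₁'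

open Abelian

/-- A pair of contravariant functors between preadditive categories that are mutually adjoint on
the right, turn monomorphisms into epimorphisms, and have monic units. -/
structure ExactDuality (A : Type u') [Category.{v} A] [Preadditive A]
    (A' : Type u'') [Category.{v'} A'] [Preadditive A'] where
  /-- the contravariant functor from `A` to `A'` -/
  dual : Aᵒᵖ ⥤ A'
  /-- the contravariant functor from `A'` to `A` -/
  dual' : A'ᵒᵖ ⥤ A
  /-- the adjunction -/
  homEquiv (M : A) (N : A') : (M ⟶ dual'.obj (op N)) ≃+ (N ⟶ dual.obj (op M))
  homEquiv_comp {M₁ M₂ : A} {N : A'} (f : M₁ ⟶ M₂) (g : M₂ ⟶ dual'.obj (op N)) :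
    homEquiv M₁ N (f ≫ g) = homEquiv M₂ N g ≫ dual.map f.op
  homEquiv_comp_map {M : A} {N₁ N₂ : A'} (f : N₁ ⟶ N₂) (g : M ⟶ dual'.obj (op N₂)) :
    homEquiv M N₁ (g ≫ dual'.map f.op) = f ≫ homEquiv M N₂ g
  epi_dual {M₁ M₂ : A} (f : M₁ ⟶ M₂) [Mono f] : Epi (dual.map f.op)
  epi_dual' {N₁ N₂ : A'} (f : N₁ ⟶ N₂) [Mono f] : Epi (dual'.map f.op)
  mono_unit (M : A) : Mono ((homEquiv M _).symm (𝟙 (dual.obj (op M))))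
  mono_unit' (N : A') : Mono (homEquiv _ N (𝟙 (dual'.obj (op N))))

namespace ExactDuality

section

variable {A : Type u'} [Category.{v} A] [Preadditive A]
  {A' : Type u''} [Category.{v'} A'] [Preadditive A'] (d : ExactDuality A A')

lemma homEquiv_symm_comp {M : A} {N₁ N₂ : A'} (f : N₁ ⟶ N₂) (g : N₂ ⟶ d.dual.obj (op M)) :
    (d.homEquiv M N₁).symm (f ≫ g) = (d.homEquiv M N₂).symm g ≫ d.dual'.map f.op := by
  rw [AddEquiv.symm_apply_eq, homEquiv_comp_map, AddEquiv.apply_symm_apply]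

lemma homEquiv_symm_comp_map {M₁ M₂ : A} {N : A'} (f : M₁ ⟶ M₂) (g : N ⟶ d.dual.obj (op M₂)) :
    (d.homEquiv M₁ N).symm (g ≫ d.dual.map f.op) = f ≫ (d.homEquiv M₂ N).symm g := by
  rw [AddEquiv.symm_apply_eq, homEquiv_comp, AddEquiv.apply_symm_apply]

/-- The duality with the two categories exchanged. -/
@[simps]
def symm : ExactDuality A' A where
  dual := d.dual'
  dual' := d.dual
  homEquiv N M := (d.homEquiv M N).symm
  homEquiv_comp := d.homEquiv_symm_comp
  homEquiv_comp_map := d.homEquiv_symm_comp_map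
  epi_dual := d.epi_dual'
  epi_dual' := d.epi_dual
  mono_unit := d.mono_unit'
  mono_unit' := d.mono_unit

/-- Additivity of `dual` is not part of the structure; what is needed of it comes from additivity of
the adjunction bijection, applied to the unit. -/
lemma dual_map_zero (M₁ M₂ : A) : d.dual.map (0 : M₁ ⟶ M₂).op = 0 := by
  have := d.homEquiv_comp (0 : M₁ ⟶ M₂) ((d.homEquiv M₂ _).symm (𝟙 _))
  rw [zero_comp, map_zero, AddEquiv.apply_symm_apply, Category.id_comp] at this
  exact this.symm

lemma mono_dual {M₁ M₂ : A} (f : M₁ ⟶ M₂) [Epi f] : Mono (d.dual.map f.op) where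
  right_cancellation {N} g h w := by
    apply (d.homEquiv _ _).symm.injective
    rw [← cancel_epi f, ← d.homEquiv_symm_comp_map, ← d.homEquiv_symm_comp_map, w]

/-- Under the adjunction, extending a map into the dual of `P` along a monomorphism `f` becomes
lifting a map out of `P` through the epimorphism `d.dual'.map f.op`. -/
lemma injective_dual (P : A) [Projective P] : Injective (d.dual.obj (op P)) where
  factors {N₁ N₂} g f _ := by
    have := d.epi_dual' f
    refine ⟨d.homEquiv _ _ (Projective.factorThru ((d.homEquiv _ _).symm g) (d.dual'.map f.op)), ?_⟩
    rw [← d.homEquiv_comp_map, Projective.factorThru_comp, AddEquiv.apply_symm_apply]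

end

variable {A : Type u'} [Category.{v} A] [Abelian A]
  {A' : Type u''} [Category.{v'} A'] [Abelian A'] (d : ExactDuality A A')

/-- The dual of a short complex. -/
@[simps]
def dualShortComplex (S : ShortComplex A) : ShortComplex A' where
  f := d.dual.map S.g.op
  g := d.dual.map S.f.op
  zero := by rw [← Functor.map_comp, ← op_comp, S.zero, d.dual_map_zero]

lemma dualShortComplex_shortExact {S : ShortComplex A} (hS : S.ShortExact) :
    (d.dualShortComplex S).ShortExact := by
  have := hS.mono_f
  have := hS.epi_g
  refine @ShortComplex.ShortExact.mk _ _ _ _ ?_ (d.mono_dual S.g) (d.epi_dual S.f)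
  have : Mono (d.dualShortComplex S).f := d.mono_dual S.g
  -- By adjunction `dual` turns the cokernel `S.g` of `S.f` into a kernel: a map killed by the dual
  -- of `S.f` corresponds to one that factors through `S.g`.
  refine ShortComplex.exact_of_f_is_kernel _ (KernelFork.IsLimit.ofι' _ _ fun {N} a ha => ?_)
  change N ⟶ d.dual.obj (op S.X₂) at a
  have h0 : S.f ≫ (d.homEquiv _ _).symm a = 0 := by
    rw [← d.homEquiv_symm_comp_map, show a ≫ d.dual.map S.f.op = 0 from ha, map_zero]
  refine ⟨d.homEquiv _ _ (hS.exact.desc _ h0), ?_⟩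
  change d.homEquiv _ _ _ ≫ d.dual.map S.g.op = a
  rw [← d.homEquiv_comp, hS.exact.g_desc, AddEquiv.apply_symm_apply]

/-- A projective presentation of `M` dualizes to an embedding of the dual of `M` in an injective
object. Both sides therefore shift down together, with `M` replaced by its syzygy. In degree one,
extending a map from the syzygy to the projective is adjoint to lifting a map from `N` through the
dual epimorphism. -/
theorem subsingleton_ext_iff [HasExt.{w} A] [HasExt.{w'} A'] [EnoughProjectives A]
    (M : A) (N : A') (n : ℕ) :
    Subsingleton (Ext.{w} M (d.dual'.obj (op N)) (n + 1)) ↔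
      Subsingleton (Ext.{w'} N (d.dual.obj (op M)) (n + 1)) := by
  have hS : (ShortComplex.mk _ _ (kernel.condition (Projective.π M))).ShortExact :=
    { exact := ShortComplex.exact_kernel (Projective.π M) }
  have hD := d.dualShortComplex_shortExact hS
  have : Injective (d.dual.obj (op (Projective.over M))) := d.injective_dual _
  have hP (k : ℕ) := Ext.subsingleton_of_projective.{w} (Projective.over M) (d.dual'.obj (op N)) k
  have hI (k : ℕ) := Ext.subsingleton_of_injective.{w'} N (d.dual.obj (op (Projective.over M))) k
  induction n generalizing M with
  | zero =>
    refine (subsingleton_ext_one_iff_extend hS _ (hP 0)).trans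
      (Iff.trans ?_ (subsingleton_ext_one_iff_lift hD _ (hI 0)).symm)
    constructor
    · intro h f
      obtain ⟨g, hg⟩ := h ((d.homEquiv _ _).symm f)
      refine ⟨d.homEquiv _ _ g, ?_⟩
      exact (d.homEquiv_comp _ _).symm.trans ((AddEquiv.symm_apply_eq _).1 hg.symm).symm
    · intro h f
      obtain ⟨g, hg⟩ := h (d.homEquiv _ _ f)
      refine ⟨(d.homEquiv _ _).symm g, ?_⟩
      exact (d.homEquiv_symm_comp_map _ _).symm.trans ((AddEquiv.symm_apply_eq _).2 hg)
  | succ n ih =>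
    refine (subsingleton_ext_succ_iff_contravariant hS _ (n + 1) (hP n) (hP (n + 1))).trans
      (Iff.trans ?_ (subsingleton_ext_succ_iff_covariant hD _ (n + 1) (hI n) (hI (n + 1))).symm)
    have hS' : (ShortComplex.mk _ _
        (kernel.condition (Projective.π (kernel (Projective.π M))))).ShortExact :=
      { exact := ShortComplex.exact_kernel _ }
    -- The facts about the presentation depend on `M` and were generalized with it, so they are
    -- supplied again for the syzygy.
    exact ih _ hS' (d.dualShortComplex_shortExact hS')
      (d.injective_dual (Projective.over (kernel (Projective.π M))))
      (Ext.subsingleton_of_projective.{w} _ _)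
      (@Ext.subsingleton_of_injective _ _ _ _ _ _
        (d.injective_dual (Projective.over (kernel (Projective.π M)))))

end ExactDuality

/-! ### Exact fully faithful functors: reduction of Ext comparison to vanishing -/

lemma subsingleton_ext_map_of_cogenerating
    {B : Type u'} [Category.{v} B] [Abelian B]
    {A : Type u''} [Category.{v'} A] [Abelian A] [HasExt.{w'} A]
    (F : B ⥤ A) [F.Additive] [PreservesFiniteLimits F] [PreservesFiniteColimits F] [F.Full]
    (P : B) [Projective P] (J : ObjectProperty B)
    (hJ : ∀ Y : B, ∃ (L : B) (i : Y ⟶ L), J L ∧ Mono i)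
    (h : ∀ (L : B), J L → ∀ n : ℕ, Subsingleton (Ext.{w'} (F.obj P) (F.obj L) (n + 1)))
    (Y : B) (n : ℕ) : Subsingleton (Ext.{w'} (F.obj P) (F.obj Y) (n + 1)) := by
  -- Embed `Y` in some `L` satisfying `J`; the cokernel then takes the place of `Y` one degree
  -- lower.
  induction n generalizing Y with
  | zero =>
    obtain ⟨L, i, hL, _⟩ := hJ Y
    have hS : (ShortComplex.mk _ _ (cokernel.condition i)).ShortExact :=
      { exact := ShortComplex.exact_cokernel i }
    refine (subsingleton_ext_one_iff_lift (hS.map_of_exact F) _ (h L hL 0)).2 fun f => ?_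
    -- `F.obj P` need not be projective, but by fullness the lifting problem comes from `B`, where
    -- `P` is projective.
    obtain ⟨f, rfl⟩ := F.map_surjective f
    exact ⟨F.map (Projective.factorThru f (cokernel.π i)),
      (F.map_comp _ _).symm.trans (congrArg F.map (Projective.factorThru_comp _ _))⟩
  | succ n ih =>
    obtain ⟨L, i, hL, _⟩ := hJ Y
    have hS : (ShortComplex.mk _ _ (cokernel.condition i)).ShortExact :=
      { exact := ShortComplex.exact_cokernel i }
    exact (subsingleton_ext_succ_iff_covariant (hS.map_of_exact F) _ (n + 1)
      (h L hL n) (h L hL (n + 1))).2 (ih _)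

section FullyFaithful

variable {B : Type u'} [Category.{v} B] [Abelian B] [HasExt.{w} B]
  {A : Type u''} [Category.{v'} A] [Abelian A] [HasExt.{w'} A]
  (F : B ⥤ A) [F.Additive] [PreservesFiniteLimits F] [PreservesFiniteColimits F]
  [F.Full] [F.Faithful]

attribute [local simp] Ext.mapExactFunctor_comp Ext.mapExactFunctor_mk₀ Ext.mapExactFunctor_extClass

attribute [local instance] Ext.subsingleton_of_projective in
lemma mapExt_bijective_of_subsingleton [EnoughProjectives B]
    (h : ∀ (P Y : B) [Projective P] (n : ℕ), Subsingleton (Ext.{w'} (F.obj P) (F.obj Y) (n + 1)))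
    (X Y : B) (n : ℕ) : Function.Bijective (F.mapExtAddHom X Y n) := by
  induction n generalizing X with
  | zero =>
    simpa [Ext.mapExactFunctor₀] using
      ⟨Functor.Faithful.map_injective, Functor.Full.map_surjective⟩
  | succ n hn =>
    let P : ProjectivePresentation X := Classical.arbitrary _
    let S := ShortComplex.mk _ _ (kernel.condition P.f)
    have : Projective S.X₂ := P.projective
    have := h S.X₂ Y n
    have : Subsingleton (Ext.{w'} (S.map F).X₂ (F.obj Y) (n + 1)) := this
    have hS : S.ShortExact := { exact := ShortComplex.exact_kernel P.f }
    -- Both `Ext^(n+1)` groups of the middle term vanish, so each `Ext^(n+1)` group of the quotient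
    -- is the cokernel of `Ext^n` of the middle term mapping to `Ext^n` of the kernel; the induction
    -- hypothesis compares these cokernels.
    exact AddMonoidHom.bijective_of_surjective_of_bijective_of_right_exact _ _ _ _
      (F.mapExtAddHom S.X₂ Y n) (F.mapExtAddHom S.X₁ Y n) (F.mapExtAddHom S.X₃ Y (n + 1))
      (by cat_disch) (by cat_disch)
      ((ShortComplex.ab_exact_iff_function_exact _).1
        (Ext.contravariant_sequence_exact₁' hS Y n (n + 1) (add_comm 1 n)))
      ((ShortComplex.ab_exact_iff_function_exact _).1
        (Ext.contravariant_sequence_exact₁' (hS.map F) (F.obj Y) n (n + 1) (add_comm 1 n)))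
      (hn _).surjective (hn _)
      (fun x₃ ↦ Ext.contravariant_sequence_exact₃ hS _ x₃ (by subsingleton) (add_comm 1 n))
      (fun y₃ ↦ Ext.contravariant_sequence_exact₃ (hS.map F) _ y₃ (by subsingleton) (add_comm 1 n))

variable {B' : Type u₁} [Category.{v₁} B'] [Abelian B']
  {A' : Type u₁'} [Category.{v₁'} A'] [Abelian A']
  (F' : B' ⥤ A') [F'.Additive] [PreservesFiniteLimits F'] [PreservesFiniteColimits F']
  (d : ExactDuality A A')

lemma ExactDuality.mapExt_bijective_iff [EnoughProjectives B] [EnoughProjectives B']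
    (hd : ∀ X : B, ∃ Y : B', Nonempty (F'.obj Y ≅ d.dual.obj (op (F.obj X))))
    (hd' : ∀ Y : B', ∃ X : B, Nonempty (F.obj X ≅ d.dual'.obj (op (F'.obj Y)))) :
    (∀ (X Y : B) (n : ℕ), Function.Bijective (F.mapExtAddHom X Y n)) ↔
      ∀ (P : B) (Q : B') [Projective P] [Projective Q] (n : ℕ),
        Subsingleton (Ext.{w'} (F.obj P) (d.dual'.obj (op (F'.obj Q))) (n + 1)) := by
  constructor
  · intro H P Q _ _ n
    obtain ⟨L, ⟨e⟩⟩ := hd' Q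
    have := Ext.subsingleton_of_projective.{w} P L n
    have : Subsingleton (Ext.{w'} (F.obj P) (F.obj L) (n + 1)) :=
      -- Only surjectivity is needed: the source vanishes because `P` is projective in `B`.
      (H P L (n + 1)).surjective.subsingleton
    exact subsingleton_ext_of_iso (Iso.refl _) e _
  · intro H
    refine mapExt_bijective_of_subsingleton F fun P Y _ n =>
      subsingleton_ext_map_of_cogenerating F P
        (fun L => ∃ Q : B', Projective Q ∧ Nonempty (F.obj L ≅ d.dual'.obj (op (F'.obj Q))))
        (fun Y => ?_) ?_ Y n
    · obtain ⟨G, ⟨e⟩⟩ := hd Y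
      let Q := Projective.over G
      obtain ⟨L, ⟨e'⟩⟩ := hd' Q
      have := d.mono_unit (F.obj Y)
      have : Mono (d.dual'.map (F'.map (Projective.π G)).op) := d.symm.mono_dual _
      -- The unit into the double dual, followed by the dual of the epimorphism `Q ↠ G`, where `G`
      -- represents the dual of `Y`. Fullness and faithfulness bring this monomorphism back to `B`.
      let j : F.obj Y ⟶ F.obj L := (d.homEquiv _ _).symm (𝟙 _) ≫ d.dual'.map e.hom.op ≫
        d.dual'.map (F'.map (Projective.π G)).op ≫ e'.inv
      obtain ⟨i, hi⟩ := F.map_surjective j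
      have : Mono (F.map i) := hi ▸ (inferInstance : Mono j)
      exact ⟨L, i, ⟨Q, inferInstance, ⟨e'⟩⟩, F.mono_of_mono_map this⟩
    · rintro L ⟨Q, _, ⟨e⟩⟩ n
      have := H P Q n
      exact subsingleton_ext_of_iso (Iso.refl _) e.symm _

theorem ExactDuality.mapExt_bijective_iff_mapExt_bijective
    [HasExt.{w} B'] [HasExt.{w'} A'] [F'.Full] [F'.Faithful]
    [EnoughProjectives B] [EnoughProjectives B'] [EnoughProjectives A]
    (hd : ∀ X : B, ∃ Y : B', Nonempty (F'.obj Y ≅ d.dual.obj (op (F.obj X))))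
    (hd' : ∀ Y : B', ∃ X : B, Nonempty (F.obj X ≅ d.dual'.obj (op (F'.obj Y)))) :
    (∀ (X Y : B) (n : ℕ), Function.Bijective (F.mapExtAddHom X Y n)) ↔
      ∀ (X Y : B') (n : ℕ), Function.Bijective (F'.mapExtAddHom X Y n) := by
  rw [d.mapExt_bijective_iff F F' hd hd', d.symm.mapExt_bijective_iff F' F hd' hd]
  exact ⟨fun h Q P _ _ n => (d.subsingleton_ext_iff _ _ n).1 (h P Q n),
    fun h P Q _ _ n => (d.subsingleton_ext_iff _ _ n).2 (h Q P n)⟩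

end FullyFaithful

end

section

variable (K : Type u) [Field K] {C : Type u} [SmallCategory C] [Preadditive C] [Linear K C]

/-! ### Projective modules -/

/-- Colimits indexed in `Type u` are needed for the coproducts of representables, indexed by all
elements of a module, that give enough projectives. -/
lemma isLinear_of_isColimit_of_small {J : Type u} [SmallCategory J]
    {F : J ⥤ C ⥤ ModuleCat.{u} K} {c : Cocone F} (hc : IsColimit c)
    (h : ∀ j, isLinear K C (F.obj j)) : isLinear K C c.pt := by
  have hom_ext {X : C} {Z : ModuleCat.{u} K} {f g : c.pt.obj X ⟶ Z}
      (w : ∀ j, (c.ι.app j).app X ≫ f = (c.ι.app j).app X ≫ g) : f = g :=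
    (isColimitOfPreserves ((evaluation C (ModuleCat.{u} K)).obj X) hc).hom_ext w
  have nat (j : J) {X Y : C} (f : X ⟶ Y) : (c.ι.app j).app X ≫ c.pt.map f =
      (F.obj j).map f ≫ (c.ι.app j).app Y := ((c.ι.app j).naturality f).symm
  refine ⟨⟨fun {X Y f g} => hom_ext fun j => ?_⟩, ⟨fun {X Y} f a => hom_ext fun j => ?_⟩⟩
  · have := (h j).1
    simp only [Preadditive.comp_add, nat, Functor.map_add, Preadditive.add_comp]
  · have := (h j).2
    simp only [Linear.comp_smul, nat, Functor.map_smul, Linear.smul_comp]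

instance {J : Type u} [SmallCategory J] : (isLinear K C).IsClosedUnderColimitsOfShape J where
  colimitsOfShape_le := by
    rintro M ⟨p⟩
    exact isLinear_of_isColimit_of_small K p.isColimit p.prop_diag_obj

instance : HasCoproducts.{u} (Mod K C) := fun _ => inferInstance

variable {K}

lemma Mod.epi_of_surjective {M N : Mod K C} (f : M ⟶ N)
    (h : ∀ X, Function.Surjective (f.hom.app X)) : Epi f := by
  have (X : C) : Epi (f.hom.app X) := (ModuleCat.epi_iff_surjective _).2 (h X)
  have : Epi ((isLinear K C).ι.map f) := NatTrans.epi_of_epi_app f.hom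
  exact (isLinear K C).ι.epi_of_epi_map this

lemma Mod.mono_of_injective {M N : Mod K C} (f : M ⟶ N)
    (h : ∀ X, Function.Injective (f.hom.app X)) : Mono f := by
  have (X : C) : Mono (f.hom.app X) := (ModuleCat.mono_iff_injective _).2 (h X)
  have : Mono ((isLinear K C).ι.map f) := NatTrans.mono_of_mono_app f.hom
  exact (isLinear K C).ι.mono_of_mono_map this

lemma Mod.surjective_of_epi {M N : Mod K C} (f : M ⟶ N) [Epi f] (X : C) :
    Function.Surjective (f.hom.app X) := by
  have : Epi (((isLinear K C).ι ⋙ (evaluation C (ModuleCat.{u} K)).obj X).map f) := inferInstance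
  exact (ModuleCat.epi_iff_surjective _).1 this

lemma Mod.injective_of_mono {M N : Mod K C} (f : M ⟶ N) [Mono f] (X : C) :
    Function.Injective (f.hom.app X) := by
  have : Mono (((isLinear K C).ι ⋙ (evaluation C (ModuleCat.{u} K)).obj X).map f) := inferInstance
  exact (ModuleCat.mono_iff_injective _).1 this

variable (K) in
/-- The module `C(X, -)`. -/
def Mod.representable (X : C) : Mod K C where
  obj := (linearCoyoneda K C).obj (op X)
  property := ⟨inferInstance, ⟨fun f a => by
    ext g
    exact Linear.comp_smul _ _ _ g a f⟩⟩

/-- The morphism `C(X, -) ⟶ M` that corresponds to `m ∈ M(X)`. -/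
def Mod.ofElement (M : Mod K C) (X : C) (m : M.obj.obj X) : Mod.representable K X ⟶ M :=
  have := M.property.1
  have := M.property.2
  ObjectProperty.homMk
    { app := fun Y => ModuleCat.ofHom
        { toFun := fun f : X ⟶ Y => M.obj.map f m
          map_add' := fun f g => by rw [Functor.map_add]; rfl
          map_smul' := fun a f => by rw [Functor.map_smul]; rfl }
      naturality := fun Y Z f => by
        ext g
        exact ConcreteCategory.congr_hom (M.obj.map_comp g f) m }

lemma Mod.ofElement_id (M : Mod K C) (X : C) (m : M.obj.obj X) :
    (Mod.ofElement M X m).hom.app X (𝟙 X) = m :=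
  ConcreteCategory.congr_hom (M.obj.map_id X) m

/-- Yoneda: naturality determines such a morphism by its value at the identity. -/
lemma Mod.representable_hom_ext {M : Mod K C} {X : C} {f g : Mod.representable K X ⟶ M}
    (h : f.hom.app X (𝟙 X) = g.hom.app X (𝟙 X)) : f = g := by
  have key (k : Mod.representable K X ⟶ M) (Y : C) (a : X ⟶ Y) :
      k.hom.app Y a = M.obj.map a (k.hom.app X (𝟙 X)) := by
    have := ConcreteCategory.congr_hom (k.hom.naturality a) (𝟙 X)
    refine Eq.trans ?_ this
    exact congrArg (k.hom.app Y) (Category.id_comp a).symm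
  ext Y a
  exact (key f Y a).trans ((congrArg _ h).trans (key g Y a).symm)

instance (X : C) : Projective (Mod.representable K X) where
  factors {M N} f e _ := by
    obtain ⟨m, hm⟩ := Mod.surjective_of_epi e X (f.hom.app X (𝟙 X))
    refine ⟨Mod.ofElement M X m, Mod.representable_hom_ext (Eq.trans ?_ hm)⟩
    exact congrArg (e.hom.app X) (Mod.ofElement_id M X m)

instance : EnoughProjectives (Mod K C) where
  presentation M := ⟨{
    p := ∐ fun x : Σ X, M.obj.obj X => Mod.representable K x.1
    f := Sigma.desc fun x => Mod.ofElement M x.1 x.2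
    epi := by
      refine Mod.epi_of_surjective _ fun X m => ?_
      refine ⟨(Sigma.ι (fun x : Σ X, M.obj.obj X => Mod.representable K x.1)
        ⟨X, m⟩).hom.app X (𝟙 X), ?_⟩
      have h := Sigma.ι_desc (fun x : Σ X, M.obj.obj X => Mod.ofElement M x.1 x.2) ⟨X, m⟩
      have h' := congrArg (fun k => k.hom.app X (𝟙 X)) h
      exact h'.trans (Mod.ofElement_id M X m) }⟩

/-! ### The duality `Hom_K(-, K)` -/

variable (K) in
/-- The `K`-linear dual, as a contravariant functor on `K`-vector spaces. -/
@[simps]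
def vectorDual : (ModuleCat.{u} K)ᵒᵖ ⥤ ModuleCat.{u} K where
  obj V := ModuleCat.of K (Module.Dual K V.unop)
  map f := ModuleCat.ofHom f.unop.hom.dualMap

instance : (vectorDual K).Additive where
  map_add := by
    intro V W f g
    ext φ
    refine LinearMap.ext fun w => ?_
    exact LinearMap.map_add (show Module.Dual K V.unop from φ) _ _

lemma vectorDual_map_smul {V W : (ModuleCat.{u} K)} (f : V ⟶ W) (a : K) :
    (vectorDual K).map (a • f).op = a • (vectorDual K).map f.op := by
  ext φ
  refine LinearMap.ext fun w => ?_
  exact LinearMap.map_smul (show Module.Dual K W from φ) _ _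

/-- The module `X ↦ Hom_K(M(X), K)` over `Cᵒᵖ`. -/
def Mod.dual (M : Mod K C) : Mod K Cᵒᵖ where
  obj := M.obj.op ⋙ vectorDual K
  property := by
    have := M.property.1
    have := M.property.2
    exact ⟨⟨fun {X Y f g} => by
        change (vectorDual K).map (M.obj.map (f.unop + g.unop)).op = _
        rw [Functor.map_add, op_add, Functor.map_add]; rfl⟩,
      ⟨fun {X Y} f a => by
        change (vectorDual K).map (M.obj.map (a • f.unop)).op = _
        rw [Functor.map_smul, vectorDual_map_smul]; rfl⟩⟩

/-- The module `X ↦ Hom_K(N(X), K)` over `C`, for a module `N` over `Cᵒᵖ`. -/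
def Mod.dual' (N : Mod K Cᵒᵖ) : Mod K C where
  obj := N.obj.rightOp ⋙ vectorDual K
  property := by
    have := N.property.1
    have := N.property.2
    exact ⟨⟨fun {X Y f g} => by
        change (vectorDual K).map (N.obj.map (f.op + g.op)).op = _
        rw [Functor.map_add, op_add, Functor.map_add]; rfl⟩,
      ⟨fun {X Y} f a => by
        change (vectorDual K).map (N.obj.map (a • f.op)).op = _
        rw [Functor.map_smul, vectorDual_map_smul]; rfl⟩⟩

variable (K C) in
/-- The contravariant functor `Hom_K(-, K)` from `Mod(C)` to `Mod(Cᵒᵖ)`. -/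
def dualFunctor : (Mod K C)ᵒᵖ ⥤ Mod K Cᵒᵖ where
  obj M := M.unop.dual
  map f := ObjectProperty.homMk (Functor.whiskerRight (NatTrans.op f.unop.hom) (vectorDual K))

variable (K C) in
/-- The contravariant functor `Hom_K(-, K)` from `Mod(Cᵒᵖ)` to `Mod(C)`. -/
def dualFunctor' : (Mod K Cᵒᵖ)ᵒᵖ ⥤ Mod K C where
  obj N := N.unop.dual'
  map f := ObjectProperty.homMk (Functor.whiskerRight (NatTrans.rightOp f.unop.hom) (vectorDual K))

lemma Mod.naturality_apply {M N : Mod K C} (f : M ⟶ N) {X Y : C} (a : X ⟶ Y) (m : M.obj.obj X) :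
    f.hom.app Y (M.obj.map a m) = N.obj.map a (f.hom.app X m) :=
  ConcreteCategory.congr_hom (f.hom.naturality a) m

/-- Morphisms `M ⟶ Hom_K(N, K)` and `N ⟶ Hom_K(M, K)` are the same bilinear pairings. -/
def dualHomEquiv (M : Mod K C) (N : Mod K Cᵒᵖ) : (M ⟶ N.dual') ≃+ (N ⟶ M.dual) where
  toFun f := ObjectProperty.homMk
    { app := fun X => ModuleCat.ofHom (LinearMap.flip (f.hom.app X.unop).hom)
      naturality := fun X Y a => by
        ext n
        refine LinearMap.ext fun m => ?_
        exact (LinearMap.congr_fun (Mod.naturality_apply f a.unop m) n).symm }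
  invFun g := ObjectProperty.homMk
    { app := fun X => ModuleCat.ofHom (LinearMap.flip (g.hom.app (op X)).hom)
      naturality := fun X Y a => by
        ext m
        refine LinearMap.ext fun n => ?_
        exact (LinearMap.congr_fun (Mod.naturality_apply g a.op n) m).symm }
  left_inv _ := rfl
  right_inv _ := rfl
  map_add' _ _ := rfl

variable (K C) in
/-- The duality `Hom_K(-, K)` between `Mod(C)` and `Mod(Cᵒᵖ)`. -/
def vectorSpaceDuality : ExactDuality (Mod K C) (Mod K Cᵒᵖ) where
  dual := dualFunctor K C
  dual' := dualFunctor' K C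
  homEquiv := dualHomEquiv
  homEquiv_comp _ _ := rfl
  homEquiv_comp_map _ _ := rfl
  -- The field hypothesis enters here: functionals extend from subspaces, and they separate the
  -- points of a vector space.
  epi_dual f _ := Mod.epi_of_surjective _ fun X =>
    LinearMap.dualMap_surjective_of_injective (Mod.injective_of_mono f X.unop)
  epi_dual' f _ := Mod.epi_of_surjective _ fun X =>
    LinearMap.dualMap_surjective_of_injective (Mod.injective_of_mono f (op X))
  mono_unit _ := Mod.mono_of_injective _ fun _ => Module.eval_apply_injective K
  mono_unit' _ := Mod.mono_of_injective _ fun _ => Module.eval_apply_injective K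

/-! ### Modules over a quotient category -/

variable (I : Ideal K C)

instance : (restrict K I.π).Faithful where
  map_injective {M N f g} h := by
    ext ⟨X⟩ m
    exact ConcreteCategory.congr_hom (congrArg (fun k => k.hom.app X) h) m

instance : (restrict K I.π).Full where
  map_surjective f := ⟨ObjectProperty.homMk (CategoryTheory.Quotient.natTransLift _ f.hom), rfl⟩

/-- The modules over `C/I` are the modules over `C` that `I` annihilates. Duals of such modules are
annihilated by the opposite ideal, so they descend to `Cᵒᵖ/Iᵒᵖ` with no need to identify that
category with `(C/I)ᵒᵖ`. -/
lemma exists_restrict_iso (M : Mod K C)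
    (h : ∀ (X Y : C) (f : X ⟶ Y), f ∈ I.carrier X Y → M.obj.map f = 0) :
    ∃ N : Mod K I.Quot, Nonempty ((restrict K I.π).obj N ≅ M) := by
  have := M.property.1
  have := M.property.2
  let F : I.Quot ⥤ ModuleCat.{u} K := CategoryTheory.Quotient.lift I.rel M.obj fun X Y f g hfg => by
    rw [← sub_eq_zero, ← Functor.map_sub]
    exact h X Y _ hfg
  have hF : isLinear K I.Quot F := by
    refine ⟨⟨?_⟩, ⟨?_⟩⟩
    · rintro ⟨X⟩ ⟨Y⟩ ⟨f⟩ ⟨g⟩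
      exact M.obj.map_add (f := f) (g := g)
    · rintro ⟨X⟩ ⟨Y⟩ ⟨f⟩ a
      exact M.obj.map_smul a f
  exact ⟨⟨F, hF⟩, ⟨(isLinear K C).isoMk (Iso.refl _)⟩⟩

lemma map_eq_zero_of_mem (N : Mod K I.Quot) {X Y : C} {f : X ⟶ Y} (hf : f ∈ I.carrier X Y) :
    N.obj.map (I.π.map f) = 0 := by
  have := N.property.1
  have h : I.π.map f = I.π.map 0 := CategoryTheory.Quotient.sound _ (by simpa [Ideal.rel] using hf)
  rw [h, Functor.map_zero, Functor.map_zero]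

lemma exists_restrict_iso_dual (N : Mod K I.Quot) : ∃ N' : Mod K I.op.Quot,
    Nonempty ((restrict K I.op.π).obj N' ≅ ((restrict K I.π).obj N).dual) := by
  refine exists_restrict_iso _ _ fun X Y f hf => ?_
  change (vectorDual K).map (N.obj.map (I.π.map f.unop)).op = 0
  rw [map_eq_zero_of_mem I N hf, op_zero, Functor.map_zero]

lemma exists_restrict_iso_dual' (N : Mod K I.op.Quot) : ∃ N' : Mod K I.Quot,
    Nonempty ((restrict K I.π).obj N' ≅ ((restrict K I.op.π).obj N).dual') := by
  refine exists_restrict_iso _ _ fun X Y f hf => ?_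
  change (vectorDual K).map (N.obj.map (I.op.π.map f.op)).op = 0
  rw [map_eq_zero_of_mem I.op N (X := op Y) (Y := op X) (f := f.op) hf, op_zero, Functor.map_zero]

end

end KCat

end

theorem proposition3p8 {K : Type u} [Field K] {C : Type u} [SmallCategory C]
    [Preadditive C] [Linear K C] (I : KCat.Ideal K C) :
    I.ProjectionIsHomologicalEpi ↔ I.op.ProjectionIsHomologicalEpi := by
  let : HasExt.{u + 1} (KCat.Mod K I.Quot) := HasExt.standard _
  let : HasExt.{u + 1} (KCat.Mod K C) := HasExt.standard _
  let : HasExt.{u + 1} (KCat.Mod K I.op.Quot) := HasExt.standard _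
  let : HasExt.{u + 1} (KCat.Mod K Cᵒᵖ) := HasExt.standard _
  -- The `K`-linear map on Ext and the additive map of the general theorem have the same underlying
  -- function, so the statements agree definitionally.
  exact (KCat.vectorSpaceDuality K C).mapExt_bijective_iff_mapExt_bijective
    (KCat.restrict K I.π) (KCat.restrict K I.op.π)
    (KCat.exists_restrict_iso_dual I) (KCat.exists_restrict_iso_dual' I)
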